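/- Let $X$ be a real linear space, let $D\subseteq X$ be a nonempty convex set, let $1\le k\le n$ be integers and let $\chi:\{1,\dots,k\}\to\{1,\dots,n\}$ be injective. For $m\ge 1$, a function $M:D^m\to X$ is called a *mean* on $D$ if $M(x_1,\dots,x_m)\in\operatorname{conv}\{x_1,\dots,x_m\}$ for all $x\in D^m$. For $x\in D^k$ and $y\in D$ let $(x|\chi)(y)\in D^n$ be the vector whose $i$-th coordinate is $x_j$ if $i=\chi(j)$, and $y$ if $i\notin\chi(\{1,\dots,k\})$. Let $M:D^n\to X$ be a mean on $D$ that is $\chi$-continuous, i.e. for every $x\in D^k$ the map $y\mapsto M\big((x|\chi)(y)\big)$ is continuous on $\operatorname{conv}\{x_1,\dots,x_k\}$ (with respect to the Euclidean topology of the finite-dimensional linear span of $x_1,\dots,x_k$, which contains this set and the values of the map). Then $M$ is $\chi$-reducible, i.e. there is a mean $K:D^k\to X$ on $D$ such that $$M\big((x|\chi)(K(x))\big)=K(x)\qquad\text{for all } x\in D^k .$$ -/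

import Mathlib

noncomputable section

/-- For `χ : {1,…,k} → {1,…,n}` injective, `x ∈ S^k` and `y ∈ S`, the vector `(x|χ)(y) ∈ S^n`
whose `χ j`-th coordinate is `x j` and whose coordinates outside the range of `χ` are `y`. -/
def fillIn {S : Type*} {k n : ℕ} (χ : Fin k → Fin n) (x : Fin k → S) (y : S) : Fin n → S :=
  Function.extend χ x (fun _ => y)

variable {X : Type*} [AddCommGroup X] [Module ℝ X]

/-- The convex hull of the entries of `x ∈ D^n`. -/
def hullOf {D : Set X} {n : ℕ} (x : Fin n → D) : Set X :=
  convexHull ℝ (Set.range fun i => (x i : X))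

/-- `M : D^n → X` is a mean on `D`. -/
def IsMean {D : Set X} {n : ℕ} (M : (Fin n → D) → X) : Prop :=
  ∀ x : Fin n → D, M x ∈ hullOf x

/-- Continuity, for a given topology on `X`, of `y ↦ M ((x|χ)(y))` on the convex hull of the
entries of `x`, for every `x ∈ D^k`. For convex `D` the hull is contained in `D`. -/
def IsChiContinuousFor (τ : TopologicalSpace X) {D : Set X} {k n : ℕ}
    (χ : Fin k → Fin n) (M : (Fin n → D) → X) : Prop :=
  letI : TopologicalSpace X := τ
  ∀ x : Fin k → D,
    ContinuousOn (fun y : D => M (fillIn χ x y)) {y : D | (y : X) ∈ hullOf x}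

/-- `χ`-continuity in a real linear space `X`. Only the Euclidean topology of the
finite-dimensional subspace spanned by the entries of `x` matters; it is the one
induced by the module topology of `X` (the finest vector topology), and equally by every
Hausdorff vector topology of `X`: see `isChiContinuous_iff`. -/
def IsChiContinuous {D : Set X} {k n : ℕ}
    (χ : Fin k → Fin n) (M : (Fin n → D) → X) : Prop :=
  IsChiContinuousFor (moduleTopology ℝ X) χ M

/-- `K : D^k → X` is a `χ`-reduction of `M : D^n → X`: it is a mean, and for every `x ∈ D^k` the
vector `y = K x` (which lies in `D`) solves `M ((x|χ)(y)) = y`. -/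
def IsChiReduction {D : Set X} {k n : ℕ} (χ : Fin k → Fin n)
    (M : (Fin n → D) → X) (K : (Fin k → D) → X) : Prop :=
  IsMean K ∧ ∀ x : Fin k → D, ∃ y : D, (y : X) = K x ∧ M (fillIn χ x y) = (y : X)

/-- `M` is `χ`-reducible. -/
def IsChiReducible {D : Set X} {k n : ℕ} (χ : Fin k → Fin n) (M : (Fin n → D) → X) : Prop :=
  ∃ K : (Fin k → D) → X, IsChiReduction χ M K

/-- All Hausdorff vector topologies induce the same topology on a finite-dimensional subspace. -/
theorem induced_subtype_le (τ σ : TopologicalSpace X)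
    (hτa : @IsTopologicalAddGroup X τ _) (hτs : @ContinuousSMul ℝ X _ _ τ) (hτ : @T2Space X τ)
    (hσa : @IsTopologicalAddGroup X σ _) (hσs : @ContinuousSMul ℝ X _ _ σ)
    (W : Submodule ℝ X) [FiniteDimensional ℝ W] :
    τ.induced (Subtype.val : W → X) ≤ σ.induced (Subtype.val : W → X) := by
  have h : @Continuous W X (τ.induced Subtype.val) σ W.subtype := by
    let : TopologicalSpace W := τ.induced Subtype.val
    have h1 : IsTopologicalAddGroup W := by
      let := τ
      exact inferInstanceAs (IsTopologicalAddGroup W)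
    have h2 : ContinuousSMul ℝ W := by
      let := τ
      exact inferInstanceAs (ContinuousSMul ℝ W)
    have h3 : T2Space W := by
      let := τ
      exact inferInstanceAs (T2Space W)
    let : TopologicalSpace X := σ
    exact LinearMap.continuous_of_finiteDimensional W.subtype
  exact continuous_iff_le_induced.mp h

/-- The module topology of a real linear space is a Hausdorff vector topology. -/
theorem moduleTopology_isHausdorffVector :
    @IsTopologicalAddGroup X (moduleTopology ℝ X) _ ∧
      @ContinuousSMul ℝ X _ _ (moduleTopology ℝ X) ∧ @T2Space X (moduleTopology ℝ X) := by
  let : TopologicalSpace X := moduleTopology ℝ X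
  have : IsModuleTopology ℝ X := ⟨rfl⟩
  have : ContinuousSMul ℝ X := IsModuleTopology.toContinuousSMul ℝ X
  have : IsTopologicalAddGroup X := IsModuleTopology.topologicalAddGroup ℝ X
  refine ⟨inferInstance, inferInstance, ?_⟩
  let b := Module.Free.chooseBasis ℝ X
  have hc : Continuous (fun x : X => fun i => b.coord i x) :=
    continuous_pi fun i => IsModuleTopology.continuous_of_linearMap (b.coord i)
  refine T2Space.of_injective_continuous (f := fun x : X => fun i => b.coord i x) ?_ hc
  intro x y hxy
  exact b.ext_elem fun i => congrFun hxy i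

theorem hullOf_subset_submodule {D : Set X} {n : ℕ} (x : Fin n → D) (W : Submodule ℝ X)
    (h : ∀ i, (x i : X) ∈ W) : hullOf x ⊆ W :=
  convexHull_min (Set.range_subset_iff.mpr h) W.convex

theorem fillIn_mem {D : Set X} {k n : ℕ} (χ : Fin k → Fin n) (x : Fin k → D) (y : D)
    (W : Submodule ℝ X) (hx : ∀ j, (x j : X) ∈ W) (hy : (y : X) ∈ W) (i : Fin n) :
    ((fillIn χ x y i : D) : X) ∈ W := by
  classical
  unfold fillIn
  rw [Function.extend_def]
  split_ifs
  · exact hx _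
  · exact hy

/-- `χ`-continuity of a mean with respect to one Hausdorff vector topology on `X` implies
`χ`-continuity with respect to any other one. -/
theorem IsChiContinuousFor.of_vector (τ σ : TopologicalSpace X)
    (hτa : @IsTopologicalAddGroup X τ _) (hτs : @ContinuousSMul ℝ X _ _ τ) (hτ : @T2Space X τ)
    (hσa : @IsTopologicalAddGroup X σ _) (hσs : @ContinuousSMul ℝ X _ _ σ) (hσ : @T2Space X σ)
    {D : Set X} {k n : ℕ} (χ : Fin k → Fin n) (M : (Fin n → D) → X) (hM : IsMean M)
    (h : IsChiContinuousFor τ χ M) : IsChiContinuousFor σ χ M := by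
  intro x
  have h0 := h x
  let W : Submodule ℝ X := Submodule.span ℝ (Set.range fun j => (x j : X))
  have : FiniteDimensional ℝ W := FiniteDimensional.span_of_finite ℝ (Set.finite_range _)
  have hx : ∀ j, (x j : X) ∈ W := fun j => Submodule.subset_span ⟨j, rfl⟩
  have hτσ : τ.induced (Subtype.val : W → X) = σ.induced (Subtype.val : W → X) :=
    le_antisymm (induced_subtype_le τ σ hτa hτs hτ hσa hσs W)
      (induced_subtype_le σ τ hσa hσs hσ hτa hτs W)
  let A : Set D := {y : D | (y : X) ∈ hullOf x}
  have hA : ∀ y : A, ((y : D) : X) ∈ W := fun y => hullOf_subset_submodule x W hx y.2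
  let j : A → W := fun y => ⟨_, hA y⟩
  let g : A → W := fun y => ⟨M (fillIn χ x y),
    hullOf_subset_submodule _ W (fillIn_mem χ x y W hx (hA y)) (hM _)⟩
  have key : ∀ ρ : TopologicalSpace X,
      (letI : TopologicalSpace X := ρ
       ContinuousOn (fun y : D => M (fillIn χ x y)) A) ↔
      @Continuous A W ((ρ.induced (Subtype.val : W → X)).induced j)
        (ρ.induced (Subtype.val : W → X)) g := by
    intro ρ
    let : TopologicalSpace X := ρ
    have hdom : (ρ.induced (Subtype.val : W → X)).induced j =
        (inferInstance : TopologicalSpace A) := by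
      rw [induced_compose]
      exact (induced_compose (tγ := ρ) (f := (Subtype.val : A → D))
        (g := (Subtype.val : D → X))).symm
    rw [hdom]
    refine continuousOn_iff_continuous_domRestrict.trans ?_
    exact (continuous_induced_rng (g := g) (f := (Subtype.val : W → X)) (t₂ := ρ)
      (t₁ := inferInstance)).symm
  have h1 := (key τ).mp h0
  rw [hτσ] at h1
  exact (key σ).mpr h1

/-- In a Hausdorff topological vector space, `χ`-continuity of a mean is continuity in the given
topology. -/
theorem isChiContinuous_iff [τ : TopologicalSpace X] [IsTopologicalAddGroup X]
    [ContinuousSMul ℝ X] [T2Space X] {D : Set X} {k n : ℕ} (χ : Fin k → Fin n)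
    (M : (Fin n → D) → X) (hM : IsMean M) :
    IsChiContinuous χ M ↔ ∀ x : Fin k → D,
      ContinuousOn (fun y : D => M (fillIn χ x y)) {y : D | (y : X) ∈ hullOf x} := by
  obtain ⟨h1, h2, h3⟩ := moduleTopology_isHausdorffVector (X := X)
  exact ⟨fun h => IsChiContinuousFor.of_vector _ τ h1 h2 h3 ‹_› ‹_› ‹_› χ M hM h,
    fun h => IsChiContinuousFor.of_vector τ _ ‹_› ‹_› ‹_› h1 h2 h3 χ M hM h⟩

end

/-! For `x ∈ D^k` the map `y ↦ M ((x|χ)(y))` sends `conv {x_1, …, x_k}` continuously to itself,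
because `(x|χ)(y)` has its entries among the `x_j` and `y`; any fixed point may be taken as `K x`.
So the theorem is Brouwer's fixed point theorem for a polytope, and the file proves the form of it
that is needed.

The combinatorial input is Scarf's lemma (`exists_dominant_subset_image`), a relative of Sperner's
lemma that needs no triangulation: a finite set carries finitely many linear orders and a
coloring of its elements by the indices of the orders. It is proved by counting modulo two the
pairs of a "door" and a "room", dominant sets that differ by one element and of which the smaller,
the door, has all colors but a fixed one. A door lies in exactly
two rooms (`Scarf.card_insert_eq_two`), save for one that lies in one room
(`Scarf.card_insert_slack_eq_one`), while a room that misses a color has an even number of doors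
(`even_card_filter_image_erase`).

Applied to finer and finer grids in the simplex, with the points ordered by each coordinate, it
gives a covering theorem (`exists_mem_stdSimplex_forall_mem`) by compactness. Covering the
simplex by the sets where Nash's improvement map does not decrease the `i`-th coordinate turns this
into a coincidence theorem (`exists_eq_sum_smul`): a continuous map from the simplex to
`conv {v_1, …, v_k}` agrees somewhere with `t ↦ ∑ t_i v_i`. As the map is defined on the
simplex, the points `v_i` may be affinely dependent and no retraction onto the polytope is
needed. -/

/-! ### Scarf's lemma -/

open Finset in
/-- A set with as many elements as there are colors that misses a color is, up to the color `i`,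
fully colored after the removal of either no element or exactly two, those of the repeated
color. -/
theorem even_card_filter_image_erase {α ι : Type*} [DecidableEq α] [Fintype ι] [DecidableEq ι]
    (f : α → ι) (S : Finset α) (hS : #S = Fintype.card ι) (i : ι) (hf : S.image f ≠ univ) :
    Even #{s ∈ S | (S.erase s).image f = univ.erase i} := by
  rcases eq_empty_or_nonempty {s ∈ S | (S.erase s).image f = univ.erase i} with h | ⟨a, ha⟩
  · simp [h]
  obtain ⟨haS, ha⟩ := mem_filter.1 ha
  have hcard : #(S.erase a) = #((S.erase a).image f) := by
    rw [ha, card_erase_of_mem haS, card_erase_of_mem (mem_univ i), hS, card_univ]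
  have hinj : Set.InjOn f (S.erase a : Finset α) := card_image_iff.1 hcard.symm
  have hai : f a ≠ i := by
    rintro rfl
    apply hf
    rw [← insert_erase haS, image_insert, ha, insert_erase (mem_univ _)]
  have hfa : f a ∈ (S.erase a).image f := by simp [ha, hai]
  obtain ⟨b, hb, hba⟩ := mem_image.1 hfa
  have hab : a ≠ b := (ne_of_mem_erase hb).symm
  have hbS := mem_of_mem_erase hb
  suffices h : {s ∈ S | (S.erase s).image f = univ.erase i} = {a, b} by
    rw [h, card_pair hab]; exact even_two
  ext s
  simp only [mem_filter, mem_insert, mem_singleton]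
  constructor
  · rintro ⟨hs, hs'⟩
    by_contra! hne
    have hsi : f s ∈ (S.erase s).image f := by
      rw [hs', ← ha]
      exact mem_image_of_mem _ (mem_erase.2 ⟨hne.1, hs⟩)
    obtain ⟨u, hu, hus⟩ := mem_image.1 hsi
    have hu1 := ne_of_mem_erase hu
    by_cases hua : u = a
    · subst hua
      exact hne.2 (hinj (mem_erase.2 ⟨hne.1, hs⟩) hb (hus.symm.trans hba.symm))
    · exact hu1 (hinj (mem_erase.2 ⟨hua, mem_of_mem_erase hu⟩) (mem_erase.2 ⟨hne.1, hs⟩) hus)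
  · rintro (rfl | rfl)
    · exact ⟨haS, ha⟩
    · refine ⟨hbS, ?_⟩
      rw [← ha]
      ext u
      simp only [mem_image, mem_erase]
      constructor
      · rintro ⟨w, ⟨hw, hwS⟩, rfl⟩
        by_cases hwa : w = a
        · subst hwa; exact ⟨s, ⟨hab.symm, hbS⟩, hba⟩
        · exact ⟨w, ⟨hwa, hwS⟩, rfl⟩
      · rintro ⟨w, ⟨hw, hwS⟩, rfl⟩
        by_cases hwa : w = s
        · subst hwa; exact ⟨a, ⟨hab, haS⟩, hba.symm⟩
        · exact ⟨w, ⟨hwa, hwS⟩, rfl⟩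

namespace Scarf

variable {T ι : Type*} [DecidableEq ι]

/-- The rank functions `r i` on `T`, extended to `T ⊕ ι`: the slack element `inr j` is the
lowest one for the index `j` and lies above all of `T` for every other index. -/
noncomputable def rank (r : ι → T → ℝ) (i : ι) : T ⊕ ι → EReal
  | .inl x => (r i x : EReal)
  | .inr j => if j = i then ⊥ else ⊤

/-- A finite set `S` is dominant if every `y : T` lies, for some index `i`, weakly below all of
`S`. Such an `i` satisfies `inr i ∉ S`, since `inr i` has rank `⊥` for `i`. Thus `S` encodes the pair
of the set `S ∩ T` and the set of those `i` with `inr i ∉ S`, the indices by which it dominates. -/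
def IsDominant (r : ι → T → ℝ) (S : Finset (T ⊕ ι)) : Prop :=
  ∀ y : T, ∃ i, ∀ s ∈ S, rank r i (.inl y) ≤ rank r i s

variable {r : ι → T → ℝ}

theorem rank_inr_self (i : ι) : rank r i (.inr i) = ⊥ := by simp [rank]

theorem rank_inr_of_ne {i j : ι} (h : j ≠ i) : rank r i (.inr j) = ⊤ := by simp [rank, h]

theorem rank_inl_lt_top (i : ι) (x : T) : rank r i (.inl x) < ⊤ := by
  simp [rank]

theorem eq_of_rank_eq (hr : ∀ i, Function.Injective (r i)) {i : ι} {s t : T ⊕ ι}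
    (h : rank r i s = rank r i t) (hs : rank r i s < ⊤) : s = t := by
  rcases s with x | j <;> rcases t with y | k
  · exact congrArg _ (hr i (by simpa [rank] using h))
  · simp only [rank] at h
    split_ifs at h <;> simp at h
  · simp only [rank] at h
    split_ifs at h <;> simp at h
  · have hj : j = i := by
      by_contra hne
      simp [rank_inr_of_ne hne] at hs
    subst hj
    by_contra hne
    rw [rank_inr_self, rank_inr_of_ne (fun h' => hne (by rw [h']))] at h
    simp at h

theorem IsDominant.mono {S S' : Finset (T ⊕ ι)} (h : IsDominant r S') (hS : S ⊆ S') :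
    IsDominant r S := fun y => (h y).imp fun _ hi s hs => hi s (hS hs)

/-- Every element of a dominant set is lowest in it for some index; this is why a dominant set
has at most as many elements as there are indices. -/
theorem IsDominant.exists_forall_rank_le {S : Finset (T ⊕ ι)} (h : IsDominant r S) {s : T ⊕ ι}
    (hs : s ∈ S) : ∃ i, ∀ t ∈ S, rank r i s ≤ rank r i t := by
  rcases s with x | j
  · exact h x
  · exact ⟨j, fun t _ => by simp [rank_inr_self]⟩

open Finset

variable [Fintype T] [DecidableEq T] [Fintype ι]

/-- Let `m q` be the lowest element of `S` for the index `q`, and suppose that dropping the index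
`l` leaves a bijection from the indices to `S`. Then there is exactly one way to
add to `S` a new lowest element for `l` and keep the set dominant: the highest one for `l` among
the elements that are not lowest for any other index. -/
theorem existsUnique_insert {S : Finset (T ⊕ ι)}
    (hr : ∀ i, Function.Injective (r i)) (hdom : IsDominant r S)
    (m : ι → T ⊕ ι) (hmS : ∀ q, m q ∈ S) (hm : ∀ q, ∀ s ∈ S, rank r q (m q) ≤ rank r q s)
    (hmtop : ∀ q, rank r q (m q) < ⊤) (l : ι)
    (hinj : ∀ p q, p ≠ l → q ≠ l → m p = m q → p = q) (hsurj : ∀ s ∈ S, ∃ q, q ≠ l ∧ m q = s) :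
    ∃! s, (s ∉ S ∧ IsDominant r (insert s S)) ∧ rank r l s < rank r l (m l) := by
  classical
  let Y : Finset (T ⊕ ι) := {s | ∀ q, q ≠ l → rank r q (m q) < rank r q s}
  have hY : ∀ s, s ∈ Y ↔ ∀ q, q ≠ l → rank r q (m q) < rank r q s := fun s => by simp [Y]
  have hYne : Y.Nonempty :=
    ⟨.inr l, (hY _).2 fun q hq => by rw [rank_inr_of_ne hq.symm]; exact hmtop q⟩
  have hYtop : ∀ s ∈ Y, s = .inr l ∨ ∃ x, s = .inl x := by
    rintro (x | j) hs
    · exact .inr ⟨x, rfl⟩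
    · left
      by_contra hne
      have := (hY _).1 hs j (fun h => hne (by rw [h]))
      simp [rank_inr_self] at this
  have hYS : ∀ s ∈ Y, s ∉ S := by
    intro s hs hsS
    obtain ⟨q, hq, rfl⟩ := hsurj s hsS
    exact lt_irrefl _ ((hY _).1 hs q hq)
  have hYlt : ∀ s ∈ Y, rank r l s < ⊤ := by
    intro s hs
    obtain rfl | ⟨x, rfl⟩ := hYtop s hs
    · simp [rank_inr_self]
    · exact rank_inl_lt_top _ _
  obtain ⟨s, hsY, hsmax⟩ := Y.exists_max_image (rank r l) hYne
  have hle : rank r l s ≤ rank r l (m l) := by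
    obtain rfl | ⟨x, rfl⟩ := hYtop s hsY
    · simp [rank_inr_self]
    · obtain ⟨q, hq⟩ := hdom x
      by_cases hql : q = l
      · subst hql; exact hq _ (hmS _)
      · exact absurd ((hY _).1 hsY q hql) (not_lt.2 (hq _ (hmS q)))
  have hlt : rank r l s < rank r l (m l) := by
    refine lt_of_le_of_ne hle fun h => hYS s hsY ?_
    rw [eq_of_rank_eq hr h (hYlt s hsY)]
    exact hmS l
  refine ⟨s, ⟨⟨hYS s hsY, fun y => ?_⟩, hlt⟩, ?_⟩
  · by_cases hy : Sum.inl y ∈ Y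
    · refine ⟨l, fun t ht => (hsmax _ hy).trans ?_⟩
      rcases mem_insert.1 ht with rfl | ht
      · exact le_rfl
      · exact hle.trans (hm l t ht)
    · rw [hY] at hy
      push Not at hy
      obtain ⟨q, hq, hyq⟩ := hy
      refine ⟨q, fun t ht => hyq.trans ?_⟩
      rcases mem_insert.1 ht with rfl | ht
      · exact ((hY _).1 hsY q hq).le
      · exact hm q t ht
  · rintro t ⟨⟨htS, ht⟩, htl⟩
    have htY : t ∈ Y := by
      rw [hY]
      intro q hq
      obtain ⟨p, hp⟩ := ht.exists_forall_rank_le (mem_insert_of_mem (hmS q))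
      have hpl : p ≠ l := by
        rintro rfl
        exact absurd ((hp t (mem_insert_self _ _)).trans_lt htl)
          (not_lt.2 (hm p _ (hmS q)))
      have hpm : m p = m q :=
        eq_of_rank_eq hr (le_antisymm (hm p _ (hmS q)) (hp _ (mem_insert_of_mem (hmS p))))
          (hmtop p)
      obtain rfl := hinj p q hpl hq hpm
      refine lt_of_le_of_ne (hp t (mem_insert_self _ _)) fun h => htS ?_
      rw [← eq_of_rank_eq hr h (hmtop p)]
      exact hmS p
    refine eq_of_rank_eq hr (le_antisymm (hsmax t htY) ?_) (hYlt t htY)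
    obtain rfl | ⟨x, rfl⟩ := hYtop s hsY
    · simp [rank_inr_self]
    · obtain ⟨q, hq⟩ := ht x
      by_cases hql : q = l
      · subst hql; exact hq _ (mem_insert_self _ _)
      · exact absurd ((hY _).1 hsY q hql) (not_lt.2 (hq _ (mem_insert_of_mem (hmS q))))

open Classical in
/-- A dominant set that has an element of `T` and one element less than there are indices has
exactly two dominant one-point extensions: two indices share their lowest element, and the new
element takes over one of these two indices. -/
theorem card_insert_eq_two {S : Finset (T ⊕ ι)} (hr : ∀ i, Function.Injective (r i))
    (hdom : IsDominant r S) (hS : #S + 1 = Fintype.card ι) {x₀ : T} (hx₀ : Sum.inl x₀ ∈ S) :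
    #{s | s ∉ S ∧ IsDominant r (insert s S)} = 2 := by
  have hmin : ∀ q, ∃ s ∈ S, ∀ t ∈ S, rank r q s ≤ rank r q t := fun q =>
    S.exists_min_image (rank r q) ⟨_, hx₀⟩
  choose m hmS hm using hmin
  have hmtop : ∀ q, rank r q (m q) < ⊤ := fun q =>
    (hm q _ hx₀).trans_lt (rank_inl_lt_top q x₀)
  have hmeq : ∀ q, ∀ s ∈ S, (∀ t ∈ S, rank r q s ≤ rank r q t) → m q = s := fun q s hs h =>
    eq_of_rank_eq hr (le_antisymm (hm q s hs) (h _ (hmS q))) (hmtop q)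
  have hsurj : ∀ s ∈ S, ∃ q, m q = s := fun s hs =>
    (hdom.exists_forall_rank_le hs).imp fun q hq => hmeq q s hs hq
  obtain ⟨i, -, j, -, hij, hmij⟩ := exists_ne_map_eq_of_card_lt_of_maps_to
    (s := (univ : Finset ι)) (t := S) (f := m) (by rw [card_univ]; omega) (fun q _ => hmS q)
  have key : ∀ l l', l ≠ l' → m l = m l' →
      (∀ p q, p ≠ l → q ≠ l → m p = m q → p = q) ∧ ∀ s ∈ S, ∃ q, q ≠ l ∧ m q = s := by
    intro l l' hll hml
    have hsur : ∀ s ∈ S, ∃ q, q ≠ l ∧ m q = s := by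
      intro s hs
      obtain ⟨q, rfl⟩ := hsurj s hs
      by_cases hq : q = l
      · exact ⟨l', hll.symm, by rw [hq, hml]⟩
      · exact ⟨q, hq, rfl⟩
    have himg : (univ.erase l).image m = S := by
      ext s
      simp only [mem_image, mem_erase, mem_univ, and_true]
      exact ⟨by rintro ⟨q, -, rfl⟩; exact hmS q, hsur s⟩
    have hinj : Set.InjOn m (univ.erase l : Finset ι) := by
      rw [← card_image_iff, himg, card_erase_of_mem (mem_univ l), card_univ]
      omega
    exact ⟨fun p q hp hq h => hinj (by simpa using hp) (by simpa using hq) h, hsur⟩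
  obtain ⟨hinji, hsurji⟩ := key i j hij hmij
  obtain ⟨hinjj, hsurjj⟩ := key j i hij.symm hmij.symm
  -- The new element is lowest for `i` or for `j`, and not for both.
  have hxor : ∀ s, s ∉ S ∧ IsDominant r (insert s S) →
      (¬ rank r i s < rank r i (m i) ↔ rank r j s < rank r j (m j)) := by
    rintro s ⟨hsS, hs⟩
    have hold : ∀ e, ∃ p, m p = m e ∧ rank r p (m p) ≤ rank r p s := by
      intro e
      obtain ⟨p, hp⟩ := hs.exists_forall_rank_le (mem_insert_of_mem (hmS e))
      have := hmeq p (m e) (hmS e) fun t ht => hp t (mem_insert_of_mem ht)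
      exact ⟨p, this, this ▸ hp s (mem_insert_self _ _)⟩
    constructor
    · intro hi
      obtain ⟨q, hq⟩ := hs.exists_forall_rank_le (mem_insert_self s S)
      have hlt : rank r q s < rank r q (m q) := by
        have hle := hq _ (mem_insert_of_mem (hmS q))
        refine lt_of_le_of_ne hle fun h => hsS ?_
        rw [← eq_of_rank_eq hr h.symm (hmtop q)]
        exact hmS q
      have hqi : q ≠ i := fun h => hi (h ▸ hlt)
      by_contra hj
      have hqj : q ≠ j := fun h => hj (h ▸ hlt)
      obtain ⟨p, hp, hps⟩ := hold q
      have hpq : p ≠ q := fun h => absurd hlt (not_lt.2 (h ▸ hps))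
      by_cases hpi : p = i
      · subst hpi
        exact hqj (hinji q j hqi hij.symm (hp.symm.trans hmij))
      · exact hpq (hinji p q hpi hqi hp)
    · intro hj hi
      obtain ⟨p, hp, hps⟩ := hold i
      by_cases hpi : p = i
      · subst hpi; exact absurd hi (not_lt.2 hps)
      · obtain rfl := hinji p j hpi hij.symm (hp.trans hmij)
        exact absurd hj (not_lt.2 hps)
  have hone : ∀ l, (∃! s, (s ∉ S ∧ IsDominant r (insert s S)) ∧ rank r l s < rank r l (m l)) →
      #{s | (s ∉ S ∧ IsDominant r (insert s S)) ∧ rank r l s < rank r l (m l)} = 1 := by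
    rintro l ⟨s, hs, huniq⟩
    rw [card_eq_one]
    refine ⟨s, ?_⟩
    ext t
    simp only [mem_filter, mem_univ, true_and, mem_singleton]
    exact ⟨huniq t, fun h => h ▸ hs⟩
  have hi := hone i (existsUnique_insert hr hdom m hmS hm hmtop i hinji hsurji)
  have hj := hone j (existsUnique_insert hr hdom m hmS hm hmtop j hinjj hsurjj)
  rw [← card_filter_add_card_filter_not (fun s => rank r i s < rank r i (m i)), filter_filter,
    filter_filter, hi]
  rw [filter_congr (q := fun s => (s ∉ S ∧ IsDominant r (insert s S)) ∧
    rank r j s < rank r j (m j)) fun s _ => and_congr_right fun h => hxor s h, hj]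

open Classical in
/-- The set of all slack elements but one has exactly one dominant one-point extension: add the
highest element of `T` for the missing index. -/
theorem card_insert_slack_eq_one [Nonempty T] (hr : ∀ i, Function.Injective (r i)) (i : ι)
    {S : Finset (T ⊕ ι)} (hS : S = (univ.erase i).image Sum.inr) :
    #{s | s ∉ S ∧ IsDominant r (insert s S)} = 1 := by
  have hmemS : ∀ q, q ≠ i → (Sum.inr q : T ⊕ ι) ∈ S := fun q hq => by
    rw [hS]; exact mem_image_of_mem _ (mem_erase.2 ⟨hq, mem_univ q⟩)
  obtain ⟨x, -, hx⟩ := (univ : Finset T).exists_max_image (r i) univ_nonempty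
  rw [card_eq_one]
  refine ⟨.inl x, ?_⟩
  ext s
  simp only [mem_filter, mem_univ, true_and, mem_singleton]
  constructor
  · rintro ⟨hsS, hs⟩
    have hidx : rank r i (.inl x) ≤ rank r i s := by
      obtain ⟨q, hq⟩ := hs x
      by_cases hqi : q = i
      · subst hqi; exact hq s (mem_insert_self _ _)
      · have := hq _ (mem_insert_of_mem (hmemS q hqi))
        simp [rank] at this
    rcases s with y | j
    · have h1 : r i x ≤ r i y := by simpa [rank] using hidx
      rw [hr i (le_antisymm (hx y (mem_univ y)) h1)]
    · by_cases hj : j = i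
      · subst hj
        simp [rank] at hidx
      · exact absurd (hmemS j hj) hsS
  · rintro rfl
    refine ⟨by simp [hS], fun y => ⟨i, fun t ht => ?_⟩⟩
    rcases mem_insert.1 ht with rfl | ht
    · simpa [rank] using hx y (mem_univ y)
    · rw [hS] at ht
      obtain ⟨q, hq, rfl⟩ := mem_image.1 ht
      rw [rank_inr_of_ne (ne_of_mem_erase hq)]
      exact le_top

/-- A slack element `inr j` has the color `j`. The proof counts modulo two the pairs `S ⊆ S'` of a
door `S`, whose colors are all but a fixed `i`, and a dominant room `S'` with one more element. -/
theorem exists_isDominant_image_eq_univ [Nonempty T] [Nonempty ι]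
    (hr : ∀ i, Function.Injective (r i)) (c : T → ι) :
    ∃ S : Finset (T ⊕ ι), IsDominant r S ∧ S.image (Sum.elim c id) = univ := by
  classical
  by_contra! hno
  obtain ⟨i⟩ := ‹Nonempty ι›
  set f : T ⊕ ι → ι := Sum.elim c id with hf
  have hpos : 0 < Fintype.card ι := Fintype.card_pos_iff.2 ⟨i⟩
  let doors : Finset (Finset (T ⊕ ι)) :=
    {S | #S + 1 = Fintype.card ι ∧ S.image f = univ.erase i ∧ IsDominant r S}
  let rooms : Finset (Finset (T ⊕ ι)) := {S | #S = Fintype.card ι ∧ IsDominant r S}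
  have hcount := sum_card_bipartiteAbove_eq_sum_card_bipartiteBelow
    (s := doors) (t := rooms) (fun S S' => S ⊆ S')
  have hrooms : ∀ S' ∈ rooms, Even #(doors.bipartiteBelow (fun S S' => S ⊆ S') S') := by
    intro S' hS'
    obtain ⟨hcard, hdom⟩ := (mem_filter.1 hS').2
    have := even_card_filter_image_erase f S' hcard i (hno S' hdom)
    convert this using 1
    symm
    refine card_bij (fun s _ => S'.erase s) ?_ ?_ ?_
    · intro s hs
      obtain ⟨hsS, hs⟩ := mem_filter.1 hs
      refine mem_filter.2 ⟨mem_filter.2 ⟨mem_univ _, ?_, hs, hdom.mono (erase_subset _ _)⟩,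
        erase_subset _ _⟩
      rw [card_erase_add_one hsS, hcard]
    · intro s hs t ht h
      by_contra hne
      have h1 : t ∈ S'.erase s := mem_erase.2 ⟨fun h => hne h.symm, (mem_filter.1 ht).1⟩
      simp only [h] at h1
      simp at h1
    · intro S hS
      obtain ⟨hS, hsub⟩ := mem_filter.1 hS
      obtain ⟨hSc, hSi, -⟩ := (mem_filter.1 hS).2
      obtain ⟨s, hs, rfl⟩ := (covBy_iff_card_sdiff_eq_one.2
        ⟨hsub, by rw [card_sdiff_of_subset hsub]; omega⟩).exists_finset_insert
      refine ⟨s, mem_filter.2 ⟨mem_insert_self _ _, ?_⟩, erase_insert hs⟩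
      rw [erase_insert hs, hSi]
  have hdoors : ∀ S ∈ doors, #(rooms.bipartiteAbove (fun S S' => S ⊆ S') S) =
      #{s | s ∉ S ∧ IsDominant r (insert s S)} := by
    intro S hS
    obtain ⟨hSc, hSi, -⟩ := (mem_filter.1 hS).2
    symm
    refine card_bij (fun s _ => insert s S) ?_ ?_ ?_
    · intro s hs
      obtain ⟨hsS, hs⟩ := (mem_filter.1 hs).2
      refine mem_filter.2 ⟨mem_filter.2 ⟨mem_univ _, ?_, hs⟩, subset_insert _ _⟩
      rw [card_insert_of_notMem hsS, hSc]
    · intro s hs t ht h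
      exact (insert_inj (mem_filter.1 hs).2.1).1 h
    · intro S' hS'
      obtain ⟨hS', hsub⟩ := mem_filter.1 hS'
      obtain ⟨hSc', hdom⟩ := (mem_filter.1 hS').2
      obtain ⟨s, hs, rfl⟩ := (covBy_iff_card_sdiff_eq_one.2
        ⟨hsub, by rw [card_sdiff_of_subset hsub]; omega⟩).exists_finset_insert
      exact ⟨s, mem_filter.2 ⟨mem_univ _, hs, hdom⟩, rfl⟩
  let S₀ : Finset (T ⊕ ι) := (univ.erase i).image Sum.inr
  have hS₀ : S₀ ∈ doors := by
    refine mem_filter.2 ⟨mem_univ _, ?_, ?_, fun y => ⟨i, fun s hs => ?_⟩⟩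
    · rw [card_image_of_injective _ Sum.inr_injective, card_erase_add_one (mem_univ i), card_univ]
    · rw [image_image]
      exact image_id
    · obtain ⟨q, hq, rfl⟩ := mem_image.1 hs
      rw [rank_inr_of_ne (ne_of_mem_erase hq)]
      exact le_top
  have htwo : ∀ S ∈ doors.erase S₀, Even #(rooms.bipartiteAbove (fun S S' => S ⊆ S') S) := by
    intro S hS
    obtain ⟨hne, hS⟩ := mem_erase.1 hS
    obtain ⟨hSc, hSi, hdom⟩ := (mem_filter.1 hS).2
    rw [hdoors S hS]
    have : ∃ x, Sum.inl x ∈ S := by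
      by_contra! hinl
      refine hne (eq_of_subset_of_card_le ?_ ?_)
      · rintro (x | j) hs
        · exact absurd hs (hinl x)
        · refine mem_image_of_mem _ ?_
          rw [← hSi]
          exact mem_image.2 ⟨_, hs, rfl⟩
      · have := (mem_filter.1 hS₀).2.1
        omega
    obtain ⟨x, hx⟩ := this
    rw [card_insert_eq_two hr hdom hSc hx]
    exact even_two
  rw [← add_sum_erase _ _ hS₀, hdoors _ hS₀, card_insert_slack_eq_one hr i rfl] at hcount
  have h1 : Even (∑ S ∈ doors.erase S₀, #(rooms.bipartiteAbove (fun S S' => S ⊆ S') S)) :=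
    even_sum _ htwo
  have h2 : Even (∑ S' ∈ rooms, #(doors.bipartiteBelow (fun S S' => S ⊆ S') S')) :=
    even_sum _ hrooms
  rw [← hcount] at h2
  exact absurd h2 (by rw [Nat.not_even_iff_odd]; exact h1.one_add)

end Scarf

open Finset in
/-- **Scarf's lemma**, colored version. The slack elements of a fully colored dominant set
`S ⊆ T ⊕ ι` account for the colors outside of `C`, so those in `C` occur on `D = S ∩ T`. -/
theorem exists_dominant_subset_image {T ι : Type*} [Finite T] [Nonempty T] [Finite ι]
    [Nonempty ι] [DecidableEq ι] (r : ι → T → ℝ) (hr : ∀ i, Function.Injective (r i)) (c : T → ι) :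
    ∃ (D : Finset T) (C : Finset ι), C ⊆ D.image c ∧ ∀ y, ∃ i ∈ C, ∀ x ∈ D, r i y ≤ r i x := by
  classical
  have := Fintype.ofFinite T
  have := Fintype.ofFinite ι
  obtain ⟨S, hdom, hS⟩ := Scarf.exists_isDominant_image_eq_univ hr c
  refine ⟨({x | Sum.inl x ∈ S} : Finset T), ({i | Sum.inr i ∉ S} : Finset ι),
    fun i hi => ?_, fun y => ?_⟩
  · obtain ⟨x | j, hs, rfl⟩ := mem_image.1 (hS ▸ mem_univ i)
    · exact mem_image.2 ⟨x, by simpa using hs, rfl⟩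
    · simp at hi
      exact absurd hs hi
  · obtain ⟨i, hi⟩ := hdom y
    refine ⟨i, ?_, fun x hx => ?_⟩
    · simp only [mem_filter, mem_univ, true_and]
      intro h
      simpa [Scarf.rank] using hi _ h
    · simpa [Scarf.rank] using hi (.inl x) (by simpa using hx)

open Finset in
/-- Scarf's lemma on the grid of all `a : ι → ℕ` with sum `N`, ordered by each coordinate: the
points of the dominant set are close to each other in all coordinates, and in every coordinate `i`
they are small unless one of them has the color `i`. Here `x` is any of these points. -/
theorem exists_grid_point {ι : Type*} [Fintype ι] [Nonempty ι] [DecidableEq ι] (N : ℕ)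
    (c : (ι → ℕ) → ι) :
    ∃ x : ι → ℕ, ∑ i, x i = N ∧ ∀ i, x i < Fintype.card ι ∨
      ∃ z : ι → ℕ, ∑ j, z j = N ∧ c z = i ∧
        ∀ j, x j < z j + Fintype.card ι ∧ z j < x j + Fintype.card ι := by
  classical
  let T : Finset (ι → ℕ) := piAntidiag univ N
  have hT : ∀ a, a ∈ T ↔ ∑ i, a i = N := fun a => by simp [T, mem_piAntidiag]
  obtain ⟨i₀⟩ := ‹Nonempty ι›
  have : Nonempty T := ⟨⟨Pi.single i₀ N, by rw [hT]; simp⟩⟩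
  -- Ties in a coordinate are broken by an enumeration `e` of the grid.
  let e := Fintype.equivFin T
  let r : ι → T → ℝ := fun i a => ((a.1 i * Fintype.card T + e a : ℕ) : ℝ)
  have hrle : ∀ i a b, r i a ≤ r i b → a.1 i ≤ b.1 i := by
    intro i a b h
    have h' : a.1 i * Fintype.card T + e a ≤ b.1 i * Fintype.card T + e b := by
      simpa only [r, Nat.cast_le] using h
    by_contra! hlt
    have h1 : (b.1 i + 1) * Fintype.card T ≤ a.1 i * Fintype.card T := Nat.mul_le_mul_right _ hlt
    have h2 := (e b).2
    rw [add_mul, one_mul] at h1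
    omega
  have hr : ∀ i, Function.Injective (r i) := by
    intro i a b h
    have h1 : a.1 i = b.1 i := le_antisymm (hrle i a b h.le) (hrle i b a h.ge)
    have h2 : a.1 i * Fintype.card T + e a = b.1 i * Fintype.card T + e b := by
      simpa only [r, Nat.cast_inj] using h
    rw [h1] at h2
    exact e.injective (Fin.ext (Nat.add_left_cancel h2))
  have : Nonempty ι := ⟨i₀⟩
  obtain ⟨D, C, hC, hdom⟩ := exists_dominant_subset_image r hr fun a => c a.1
  obtain ⟨i₁, hi₁, -⟩ := hdom (Classical.arbitrary T)
  obtain ⟨x, hxD, -⟩ := mem_image.1 (hC hi₁)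
  have hmin : ∀ i, ∃ a ∈ D, ∀ b ∈ D, r i a ≤ r i b := fun i => D.exists_min_image (r i) ⟨x, hxD⟩
  choose m hmD hm using hmin
  -- Otherwise some grid point would exceed the minima over `D` in all coordinates in `C`.
  have hsum : N < ∑ i ∈ C, ((m i).1 i + 1) := by
    by_contra! hle
    obtain ⟨d, hd⟩ := Nat.exists_eq_add_of_le hle
    let y : ι → ℕ := fun i =>
      (if i ∈ C then (m i).1 i + 1 else 0) + Pi.single (M := fun _ => ℕ) i₀ d i
    have hy : y ∈ T := by
      rw [hT, sum_add_distrib, sum_ite_mem, univ_inter, hd]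
      simp
    obtain ⟨i, hi, hyi⟩ := hdom ⟨y, hy⟩
    have h1 := hrle i _ _ (hyi (m i) (hmD i))
    simp only [y, if_pos hi] at h1
    omega
  rw [sum_add_distrib, sum_const, smul_eq_mul, mul_one] at hsum
  have hCcard : #C ≤ Fintype.card ι := card_le_univ C
  have hle : ∀ a ∈ D, ∀ i, (m i).1 i ≤ a.1 i := fun a ha i => hrle i _ _ (hm i a ha)
  have hin : ∀ a ∈ D, ∀ i ∈ C, a.1 i < (m i).1 i + Fintype.card ι := by
    intro a ha i hi
    have h1 : ∑ j ∈ C, a.1 j ≤ N := by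
      rw [← (hT _).1 a.2]
      exact sum_le_sum_of_subset (subset_univ C)
    rw [← add_sum_erase _ _ hi] at h1 hsum
    have h2 : ∑ j ∈ C.erase i, (m j).1 j ≤ ∑ j ∈ C.erase i, a.1 j :=
      sum_le_sum fun j _ => hle a ha j
    omega
  have hout : ∀ a ∈ D, ∀ i, i ∉ C → a.1 i < Fintype.card ι := by
    intro a ha i hi
    have h1 : ∑ j ∈ insert i C, a.1 j ≤ N := by
      rw [← (hT _).1 a.2]
      exact sum_le_sum_of_subset (subset_univ _)
    rw [sum_insert hi] at h1
    have h2 : ∑ j ∈ C, (m j).1 j ≤ ∑ j ∈ C, a.1 j := sum_le_sum fun j _ => hle a ha j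
    omega
  have hclose : ∀ a ∈ D, ∀ b ∈ D, ∀ j, a.1 j < b.1 j + Fintype.card ι := by
    intro a ha b hb j
    by_cases hj : j ∈ C
    · have := hin a ha j hj
      have := hle b hb j
      omega
    · have := hout a ha j hj
      omega
  refine ⟨x.1, (hT _).1 x.2, fun i => ?_⟩
  by_cases hi : i ∈ C
  · obtain ⟨z, hz, hzi⟩ := mem_image.1 (hC hi)
    exact .inr ⟨z.1, (hT _).1 z.2, hzi, fun j => ⟨hclose x hxD z hz j, hclose z hz x hxD j⟩⟩
  · exact .inl (hout x hxD i hi)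

/-! ### Covering and coincidence theorems on the simplex -/

open Filter Topology in
/-- A covering theorem of Knaster–Kuratowski–Mazurkiewicz type: if finitely many closed sets `F i`
cover the simplex with vertices `i`, then some point of the simplex lies in `F i` for all `i` in
its support. -/
theorem exists_mem_stdSimplex_forall_mem {ι : Type*} [Fintype ι] [Nonempty ι]
    (F : ι → Set (ι → ℝ)) (hF : ∀ i, IsClosed (F i)) (hcover : stdSimplex ℝ ι ⊆ ⋃ i, F i) :
    ∃ t ∈ stdSimplex ℝ ι, ∀ i, t i ≠ 0 → t ∈ F i := by
  classical
  let p : ℕ → (ι → ℕ) → ι → ℝ := fun N a i => (a i : ℝ) / N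
  have hp : ∀ N : ℕ, 0 < N → ∀ a : ι → ℕ, ∑ i, a i = N → p N a ∈ stdSimplex ℝ ι := by
    intro N hN a ha
    refine ⟨fun i => by positivity, ?_⟩
    rw [← Finset.sum_div, ← Nat.cast_sum, ha, div_self (by positivity)]
  have hlabel : ∀ q : ι → ℝ, ∃ i, q ∈ stdSimplex ℝ ι → q ∈ F i := by
    intro q
    by_cases hq : q ∈ stdSimplex ℝ ι
    · exact (Set.mem_iUnion.1 (hcover hq)).imp fun _ h _ => h
    · exact ⟨Classical.arbitrary ι, fun h => absurd h hq⟩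
  choose lab hlab using hlabel
  let k : ℝ := Fintype.card ι
  have happrox : ∀ n : ℕ, ∃ t ∈ stdSimplex ℝ ι, ∀ i, t i ≤ k / ((n : ℝ) + 1) ∨
      ∃ z ∈ F i, dist z t ≤ k / ((n : ℝ) + 1) := by
    intro n
    have hn : (0 : ℝ) < (n : ℝ) + 1 := by positivity
    obtain ⟨x, hx, hxi⟩ := exists_grid_point (n + 1) fun a => lab (p (n + 1) a)
    refine ⟨p (n + 1) x, hp _ n.succ_pos x hx, fun i => ?_⟩
    rcases hxi i with h | ⟨z, hz, rfl, hzx⟩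
    · left
      simp only [p, Nat.cast_add, Nat.cast_one, k]
      gcongr
    · refine .inr ⟨p (n + 1) z, hlab _ (hp _ n.succ_pos z hz), ?_⟩
      rw [dist_pi_le_iff (by positivity)]
      intro j
      simp only [p, Nat.cast_add, Nat.cast_one, k]
      rw [Real.dist_eq, ← sub_div, abs_div, abs_of_pos hn]
      gcongr
      obtain ⟨h1, h2⟩ := hzx j
      have h1' : (x j : ℝ) < z j + Fintype.card ι := by exact_mod_cast h1
      have h2' : (z j : ℝ) < x j + Fintype.card ι := by exact_mod_cast h2
      rw [abs_le]
      constructor <;> linarith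
  choose u hu hui using happrox
  obtain ⟨t, ht, φ, hφ, hlim⟩ := (isCompact_stdSimplex ℝ ι).tendsto_subseq hu
  have hk : Tendsto (fun n => k / ((φ n : ℝ) + 1)) atTop (𝓝 0) :=
    ((tendsto_natCast_atTop_atTop (R := ℝ)).atTop_add tendsto_const_nhds).const_div_atTop k
      |>.comp hφ.tendsto_atTop
  refine ⟨t, ht, fun i hi => ?_⟩
  have hti : 0 < t i := lt_of_le_of_ne (ht.1 i) hi.symm
  have hlimi : Tendsto (fun n => u (φ n) i) atTop (𝓝 (t i)) := (tendsto_pi_nhds.1 hlim) i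
  rw [← (hF i).closure_eq, Metric.mem_closure_iff]
  intro ε hε
  obtain ⟨n, h1, h2, h3⟩ := ((hk.eventually_lt hlimi hti).and
    ((hk.eventually_lt_const (half_pos hε)).and
      (Metric.tendsto_nhds.1 hlim _ (half_pos hε)))).exists
  rcases hui (φ n) i with h | ⟨z, hz, hzd⟩
  · exact absurd h1 (not_lt.2 h)
  · refine ⟨z, hz, ?_⟩
    rw [dist_comm] at h3 hzd
    have := dist_triangle t (u (φ n)) z
    simp only [Function.comp] at h3
    linarith

/-- A continuous map `g` from the simplex to the convex hull of the points `v i` agrees at some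
point with the affine map that sends the vertices to the `v i`. With
`G i = max 0 ⟪g t - y, v i - y⟫`, where `y = ∑ t i • v i`, the sets `t i * ∑ G ≤ G i` cover the
simplex; this is the inequality that a fixed point of Nash's map `t i ↦ (t i + G i) / (1 + ∑ G)`
satisfies. -/
theorem exists_eq_sum_smul {ι E : Type*} [Fintype ι] [Nonempty ι] [NormedAddCommGroup E]
    [InnerProductSpace ℝ E] (v : ι → E) (g : (ι → ℝ) → E)
    (hg : ContinuousOn g (stdSimplex ℝ ι))
    (hmaps : ∀ t ∈ stdSimplex ℝ ι, g t ∈ convexHull ℝ (Set.range v)) :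
    ∃ t ∈ stdSimplex ℝ ι, g t = ∑ i, t i • v i := by
  let y : (ι → ℝ) → E := fun t => ∑ i, t i • v i
  have hy : Continuous y := by fun_prop
  let G : ι → (ι → ℝ) → ℝ := fun i t => max 0 (inner ℝ (g t - y t) (v i - y t))
  have hG0 : ∀ i t, 0 ≤ G i t := fun i t => le_max_left _ _
  have hG : ∀ i, ContinuousOn (G i) (stdSimplex ℝ ι) := fun i =>
    ContinuousOn.sup continuousOn_const ((hg.sub hy.continuousOn).inner (𝕜 := ℝ)
      (continuousOn_const.sub hy.continuousOn))
  let F : ι → Set (ι → ℝ) := fun i => {t ∈ stdSimplex ℝ ι | t i * ∑ j, G j t ≤ G i t}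
  have hF : ∀ i, IsClosed (F i) := fun i =>
    (isClosed_stdSimplex ℝ ι).isClosed_le
      ((continuous_apply i).continuousOn.mul (continuousOn_finsetSum _ fun j _ => hG j)) (hG i)
  have hcover : stdSimplex ℝ ι ⊆ ⋃ i, F i := by
    intro t ht
    rw [Set.mem_iUnion]
    by_contra! h
    have hlt : ∀ i, G i t < t i * ∑ j, G j t := fun i => by
      by_contra! hle
      exact h i ⟨ht, hle⟩
    have := Finset.sum_lt_sum_of_nonempty Finset.univ_nonempty fun i _ => hlt i
    rw [← Finset.sum_mul, ht.2, one_mul] at this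
    exact lt_irrefl _ this
  obtain ⟨t, ht, htF⟩ := exists_mem_stdSimplex_forall_mem F hF hcover
  have hle : ∀ i, t i * ∑ j, G j t ≤ G i t := by
    intro i
    by_cases hi : t i = 0
    · rw [hi, zero_mul]; exact hG0 i t
    · exact (htF i hi).2
  have heq : ∀ i, t i * ∑ j, G j t = G i t := by
    have := (Finset.sum_eq_sum_iff_of_le fun i (_ : i ∈ Finset.univ) => hle i).1
      (by rw [← Finset.sum_mul, ht.2, one_mul])
    exact fun i => this i (Finset.mem_univ i)
  have hzero : ∑ i, t i * inner ℝ (g t - y t) (v i - y t) = 0 := by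
    have : ∑ i, t i • (v i - y t) = 0 := by
      simp only [smul_sub, Finset.sum_sub_distrib, ← Finset.sum_smul, ht.2, one_smul]
      exact sub_self _
    simp only [← inner_smul_right, ← inner_sum, this, inner_zero_right]
  -- Some `i` in the support of `t` has `G i = 0`, because the inner products average to zero.
  obtain ⟨i, hi, hGi⟩ : ∃ i, t i ≠ 0 ∧ G i t = 0 := by
    by_contra! h
    have hpos : ∀ i, t i ≠ 0 → 0 < inner ℝ (g t - y t) (v i - y t) := fun i hi => by
      have := lt_of_le_of_ne (hG0 i t) (h i hi).symm
      exact (lt_max_iff.1 this).resolve_left (lt_irrefl _)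
    have hnn : ∀ i ∈ Finset.univ, 0 ≤ t i * inner ℝ (g t - y t) (v i - y t) := fun i _ => by
      by_cases hi : t i = 0
      · simp [hi]
      · exact mul_nonneg (ht.1 i) (hpos i hi).le
    have hall := (Finset.sum_eq_zero_iff_of_nonneg hnn).1 hzero
    have : ∑ i, t i = 0 := Finset.sum_eq_zero fun i hi => by
      by_contra hti
      exact (mul_ne_zero hti (hpos i hti).ne') (hall i hi)
    rw [ht.2] at this
    exact one_ne_zero this
  have hsum : ∑ j, G j t = 0 := by
    have := heq i
    rw [hGi] at this
    exact (mul_eq_zero.1 this).resolve_left hi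
  have hinner : ∀ i, inner ℝ (g t - y t) (v i - y t) ≤ 0 := fun i => by
    have := heq i
    rw [hsum, mul_zero] at this
    exact (le_max_right _ _).trans this.ge
  have hhalf : convexHull ℝ (Set.range v) ⊆
      {w | inner ℝ (g t - y t) w ≤ inner ℝ (g t - y t) (y t)} := by
    refine convexHull_min ?_ (convex_halfSpace_le (innerₗ E (g t - y t)).isLinear _)
    rintro _ ⟨i, rfl⟩
    have := hinner i
    rw [inner_sub_right] at this
    exact sub_nonpos.1 this
  refine ⟨t, ht, ?_⟩
  have h1 : inner ℝ (g t - y t) (g t - y t) ≤ 0 := by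
    rw [inner_sub_right]
    exact sub_nonpos.2 (hhalf (hmaps t ht))
  exact sub_eq_zero.1 (inner_self_eq_zero.1 (le_antisymm h1 real_inner_self_nonneg))

/-! ### Reducibility of means -/

theorem theorem1 {X : Type*} [AddCommGroup X] [Module ℝ X]
    (D : Set X) (hD : Convex ℝ D) (hne : D.Nonempty)
    (n k : ℕ) (hk : 1 ≤ k) (χ : Fin k → Fin n) (hχ : Function.Injective χ)
    (M : (Fin n → D) → X) (hM : IsMean M) (hcont : IsChiContinuous χ M) :
    IsChiReducible χ M := by
  suffices h : ∀ x : Fin k → D, ∃ y : D, (y : X) ∈ hullOf x ∧ M (fillIn χ x y) = y by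
    choose K hK hMK using h
    exact ⟨fun x => K x, hK, fun x => ⟨K x, rfl, hMK x⟩⟩
  intro x
  have : Nonempty (Fin k) := ⟨⟨0, hk⟩⟩
  let W : Submodule ℝ X := Submodule.span ℝ (Set.range fun j => (x j : X))
  have : FiniteDimensional ℝ W := FiniteDimensional.span_of_finite ℝ (Set.finite_range _)
  have hxW : ∀ j, (x j : X) ∈ W := fun j => Submodule.subset_span ⟨j, rfl⟩
  -- Euclidean coordinates on `W`, extended to a linear map `p` on all of `X`.
  let b := (Module.finBasis ℝ W).equivFun.trans
    (WithLp.linearEquiv 2 ℝ (Fin (Module.finrank ℝ W) → ℝ)).symm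
  obtain ⟨p, hp⟩ := b.toLinearMap.exists_extend
  have hpW : ∀ a ∈ W, ∀ a' ∈ W, p a = p a' → a = a' := by
    intro a ha a' ha' h
    have h1 : ∀ w : W, p w = b w := fun w => LinearMap.congr_fun hp w
    have h2 : b ⟨a, ha⟩ = b ⟨a', ha'⟩ := by rw [← h1, ← h1]; exact h
    exact congrArg Subtype.val (b.injective h2)
  have hhullD : hullOf x ⊆ D :=
    convexHull_min (Set.range_subset_iff.2 fun j => (x j).2) hD
  have hcomb : ∀ t ∈ stdSimplex ℝ (Fin k), ∑ j, t j • (x j : X) ∈ hullOf x := fun t ht =>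
    (convex_convexHull ℝ _).sum_mem (fun j _ => ht.1 j) ht.2
      fun j _ => subset_convexHull ℝ _ ⟨j, rfl⟩
  have hmaps : ∀ y : D, (y : X) ∈ hullOf x → M (fillIn χ x y) ∈ hullOf x := by
    intro y hy
    refine convexHull_min ?_ (convex_convexHull ℝ _) (hM (fillIn χ x y))
    rintro _ ⟨i, rfl⟩
    by_cases hi : ∃ j, χ j = i
    · obtain ⟨j, rfl⟩ := hi
      simp only [fillIn, hχ.extend_apply]
      exact subset_convexHull ℝ _ ⟨j, rfl⟩
    · have h : fillIn χ x y i = y := Function.extend_apply' _ _ _ hi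
      simp only [h]
      exact hy
  let : TopologicalSpace X := moduleTopology ℝ X
  have : IsModuleTopology ℝ X := ⟨rfl⟩
  have : ContinuousSMul ℝ X := IsModuleTopology.toContinuousSMul ℝ X
  have : IsTopologicalAddGroup X := IsModuleTopology.topologicalAddGroup ℝ X
  obtain ⟨d₀, hd₀⟩ := hne
  classical
  let y : (Fin k → ℝ) → D := fun t =>
    if h : ∑ j, t j • (x j : X) ∈ D then ⟨_, h⟩ else ⟨d₀, hd₀⟩
  have hy : ∀ t ∈ stdSimplex ℝ (Fin k), (y t : X) = ∑ j, t j • (x j : X) := fun t ht => by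
    simp only [y, dif_pos (hhullD (hcomb t ht))]
  have hycont : ContinuousOn y (stdSimplex ℝ (Fin k)) := by
    rw [Topology.IsInducing.subtypeVal.continuousOn_iff]
    have hc : Continuous fun t : Fin k → ℝ => ∑ j, t j • (x j : X) := by fun_prop
    exact hc.continuousOn.congr hy
  have hyhull : ∀ t ∈ stdSimplex ℝ (Fin k), (y t : X) ∈ hullOf x := fun t ht => by
    rw [hy t ht]; exact hcomb t ht
  have hpc : Continuous p := IsModuleTopology.continuous_of_linearMap p
  obtain ⟨t, ht, heq⟩ := exists_eq_sum_smul (fun j => p (x j))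
    (fun t => p (M (fillIn χ x (y t))))
    (hpc.comp_continuousOn ((hcont x).comp hycont hyhull))
    (fun t ht => by
      have h := Set.mem_image_of_mem p (hmaps _ (hyhull t ht))
      rwa [hullOf, p.image_convexHull, ← Set.range_comp] at h)
  have hsub := hullOf_subset_submodule x W hxW
  refine ⟨y t, hyhull t ht, hpW _ (hsub (hmaps _ (hyhull t ht))) _ (hsub (hyhull t ht)) ?_⟩
  rw [hy t ht, map_sum]
  simpa only [map_smul] using heq
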